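/- Monomodal formulas over a set of atoms are built from the atoms and $\top$ using $\neg$, $\vee$, $\lozenge$, with $\Box=\neg\lozenge\neg$. A \emph{normal logic} is a set $L$ of formulas over the atoms $q_0,q_1,q_2,\dots$ that contains all propositional tautologies and the axioms $\Box(p\to q)\to(\Box p\to\Box q)$ and $\lozenge p\leftrightarrow\neg\Box\neg p$, and is closed under modus ponens, generalisation (from $\varphi$ infer $\Box\varphi$) and uniform substitution. $K5_2$ is the smallest normal logic containing $\lozenge\lozenge p\to\Box\lozenge p$. For a set $X$ of atoms, the \emph{canonical frame} of $L$ over $X$ has as points the maximally $L$-consistent sets of formulas over $X$ (where the $L$-theorems over $X$ are the substitution instances over $X$ of members of $L$), with $\Gamma R\Delta$ iff $\lozenge\varphi\in\Gamma$ for all $\varphi\in\Delta$. For a cardinal $\kappa$, $L$ is \emph{$\kappa$-canonical} if every formula of $L$ is valid in the canonical frame of $L$ over $\kappa$ atoms, and \emph{totally canonical} if it is $\kappa$-canonical for every cardinal $\kappa$. A \emph{modal algebra} is a Boolean algebra with a unary operation $\lozenge$ such that $\lozenge 0=0$ and $\lozenge(a+b)=\lozenge a+\lozenge b$; $V_L$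 is the variety of modal algebras satisfying the equations $\varphi=1$ for $\varphi\in L$. The \emph{canonical extension} $\mathcal A^\sigma$ of a modal algebra $\mathcal A$ is the algebra of all sets of ultrafilters of $\mathcal A$, with $\lozenge X=\{\mu:\exists\nu\in X\ \forall a\in\nu\ (\lozenge a\in\mu)\}$. $V_L$ is \emph{$\kappa$-canonical} if $\mathcal A^\sigma\in V_L$ for every $\mathcal A\in V_L$ that is generated by a set of at most $\kappa$ elements, and \emph{totally canonical} if $\mathcal A^\sigma\in V_L$ for every $\mathcal A\in V_L$. \textbf{Theorem.} Let $L$ be a normal logic with $K5_2\subseteq L$. If $L$ is $\omega$-canonical, then $L$ is totally canonical. Likewise, if the variety $V_L$ is $\omega$-canonical, then $V_L$ is totally canonical. -/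

import Mathlib

universe u v

namespace ModalLogic

/-! ## Formulas and normal logics -/

/-- Monomodal formulas over a set `α` of propositional atoms. -/
inductive Formula (α : Type u) : Type u
  | atom : α → Formula α
  | verum : Formula α
  | neg : Formula α → Formula α
  | disj : Formula α → Formula α → Formula α
  | dia : Formula α → Formula α

namespace Formula

variable {α : Type u} {β : Type v}

/-- Falsum. -/
def falsum : Formula α := neg verum

/-- Conjunction. -/
def conj (φ ψ : Formula α) : Formula α := neg (disj (neg φ) (neg ψ))

/-- Implication. -/
def imp (φ ψ : Formula α) : Formula α := disj (neg φ) ψ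

/-- Equivalence. -/
def equiv (φ ψ : Formula α) : Formula α := conj (imp φ ψ) (imp ψ φ)

/-- The box modality, dual to the diamond. -/
def box (φ : Formula α) : Formula α := neg (dia (neg φ))

/-- Uniform substitution of formulas for atoms. -/
def subst (σ : α → Formula β) : Formula α → Formula β
  | atom a => σ a
  | verum => verum
  | neg φ => neg (subst σ φ)
  | disj φ ψ => disj (subst σ φ) (subst σ ψ)
  | dia φ => dia (subst σ φ)

/-- Conjunction of a finite list of formulas. -/
def listConj : List (Formula α) → Formula α
  | [] => verum
  | φ :: l => conj φ (listConj l)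

/-- A formula is a propositional tautology if it is true under every truth assignment that
respects the propositional connectives (atoms and formulas `◇ψ` get arbitrary truth values). -/
def IsTautology (φ : Formula α) : Prop :=
  ∀ w : Formula α → Prop,
    w verum → (∀ ψ, w (neg ψ) ↔ ¬ w ψ) → (∀ ψ χ, w (disj ψ χ) ↔ (w ψ ∨ w χ)) → w φ

end Formula

open Formula

/-- Normal monomodal logics, as sets of formulas over the atoms `q₀, q₁, q₂, …`. -/
structure IsNormalLogic (L : Set (Formula ℕ)) : Prop where
  taut : ∀ φ : Formula ℕ, φ.IsTautology → φ ∈ L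
  axiomK : imp (box (imp (atom 0) (atom 1))) (imp (box (atom 0)) (box (atom 1))) ∈ L
  axiomDual : equiv (dia (atom 0)) (neg (box (neg (atom 0)))) ∈ L
  modusPonens : ∀ φ ψ : Formula ℕ, φ ∈ L → imp φ ψ ∈ L → ψ ∈ L
  generalisation : ∀ φ : Formula ℕ, φ ∈ L → box φ ∈ L
  substitution : ∀ (φ : Formula ℕ) (σ : ℕ → Formula ℕ), φ ∈ L → φ.subst σ ∈ L

/-- The formula `◇◇p → □◇p`. -/
def axiom52 : Formula ℕ := imp (dia (dia (atom 0))) (box (dia (atom 0)))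

/-- The smallest normal logic containing `◇◇p → □◇p`. -/
def K52 : Set (Formula ℕ) := {φ | ∀ L : Set (Formula ℕ), IsNormalLogic L → axiom52 ∈ L → φ ∈ L}

/-! ## Kripke semantics -/

/-- A Kripke frame. -/
structure KripkeFrame : Type (u + 1) where
  World : Type u
  Rel : World → World → Prop

/-- Truth of a formula at a point of the model given by a frame and a valuation. -/
def KripkeFrame.Sat (F : KripkeFrame.{u}) (g : ℕ → Set F.World) : F.World → Formula ℕ → Prop
  | w, atom i => w ∈ g i
  | _, verum => True
  | w, neg φ => ¬ F.Sat g w φ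
  | w, disj φ ψ => F.Sat g w φ ∨ F.Sat g w ψ
  | w, dia φ => ∃ z, F.Rel w z ∧ F.Sat g z φ

/-- A set of formulas is valid in a frame if each of its members is true at every point under
every valuation. -/
def KripkeFrame.Validates (F : KripkeFrame.{u}) (S : Set (Formula ℕ)) : Prop :=
  ∀ φ ∈ S, ∀ (g : ℕ → Set F.World) (w : F.World), F.Sat g w φ

/-! ## Canonicity of logics through canonical frames -/

/-- The theorems of `L` in the language with set of atoms `α`: all substitution instances, in
that language, of members of `L`. -/
def theoremsOver (L : Set (Formula ℕ)) (α : Type u) : Set (Formula α) :=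
  {φ | ∃ ψ ∈ L, ∃ σ : ℕ → Formula α, φ = ψ.subst σ}

/-- `Γ` is `L`-consistent: no finite conjunction of members of `Γ` is refutable in `L`. -/
def IsConsistent (L : Set (Formula ℕ)) {α : Type u} (Γ : Set (Formula α)) : Prop :=
  ∀ l : List (Formula α), (∀ φ ∈ l, φ ∈ Γ) → neg (listConj l) ∉ theoremsOver L α

/-- The canonical frame of `L` over the set of atoms `α`. Its points are the maximally
`L`-consistent sets of formulas over `α`. -/
def canonicalFrame (L : Set (Formula ℕ)) (α : Type u) : KripkeFrame.{u} where
  World := {Γ : Set (Formula α) // Maximal (IsConsistent L) Γ}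
  Rel Γ Δ := ∀ φ : Formula α, φ ∈ Δ.1 → dia φ ∈ Γ.1

/-- `L` is `κ`-canonical: it is valid in its canonical frame over `κ` atoms. -/
def IsCanonicalInPower (L : Set (Formula ℕ)) (κ : Cardinal.{u}) : Prop :=
  ∀ α : Type u, Cardinal.mk α = κ → (canonicalFrame L α).Validates L

/-- `L` is totally canonical: it is canonical in every power (of the universe at hand). -/
def IsTotallyCanonical (L : Set (Formula ℕ)) : Prop :=
  ∀ κ : Cardinal.{u}, IsCanonicalInPower L κ

/-! ## Canonicity through varieties of modal algebras -/

/-- Boolean algebras with one normal additive operator. -/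
class ModalAlgebra (A : Type u) extends BooleanAlgebra A where
  diam : A → A
  diam_bot : diam ⊥ = ⊥
  diam_sup : ∀ a b : A, diam (a ⊔ b) = diam a ⊔ diam b

/-- The value in a modal algebra of (the term corresponding to) a formula. -/
def Formula.value {A : Type u} [ModalAlgebra A] (v : ℕ → A) : Formula ℕ → A
  | atom i => v i
  | verum => ⊤
  | neg φ => (Formula.value v φ)ᶜ
  | disj φ ψ => Formula.value v φ ⊔ Formula.value v ψ
  | dia φ => ModalAlgebra.diam (Formula.value v φ)

/-- `A` belongs to the variety `V_L`, defined by the equations `φ = 1` for `φ ∈ L`. -/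
def InVariety (L : Set (Formula ℕ)) (A : Type u) [ModalAlgebra A] : Prop :=
  ∀ φ ∈ L, ∀ v : ℕ → A, φ.value v = ⊤

/-- `S` is closed under all operations of the modal algebra `A`. -/
structure IsSubalgebra {A : Type u} [ModalAlgebra A] (S : Set A) : Prop where
  bot_mem : ⊥ ∈ S
  top_mem : ⊤ ∈ S
  compl_mem : ∀ a ∈ S, aᶜ ∈ S
  sup_mem : ∀ a ∈ S, ∀ b ∈ S, a ⊔ b ∈ S
  diam_mem : ∀ a ∈ S, ModalAlgebra.diam a ∈ S

/-- `A` is generated as an algebra by a subset of cardinality at most `κ`. -/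
def IsGeneratedInPower (A : Type u) [ModalAlgebra A] (κ : Cardinal.{u}) : Prop :=
  ∃ S : Set A, Cardinal.mk S ≤ κ ∧ ∀ T : Set A, S ⊆ T → IsSubalgebra T → T = Set.univ

/-- The canonical frame `A₊` of a modal algebra, whose points are the ultrafilters of `A`. -/
def ultrafilterFrame (A : Type u) [ModalAlgebra A] : KripkeFrame.{u} where
  World := {μ : Order.PFilter A // ⊥ ∉ μ ∧ ∀ a : A, a ∈ μ ∨ aᶜ ∈ μ}
  Rel μ ν := ∀ a : A, a ∈ ν.1 → ModalAlgebra.diam a ∈ μ.1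

/-- The canonical extension `A^σ`: the algebra of all subsets of the canonical frame `A₊`. -/
def CanonicalExtension (A : Type u) [ModalAlgebra A] : Type u :=
  Set (ultrafilterFrame A).World

instance CanonicalExtension.instModalAlgebra (A : Type u) [ModalAlgebra A] :
    ModalAlgebra (CanonicalExtension A) where
  toBooleanAlgebra := inferInstanceAs (BooleanAlgebra (Set (ultrafilterFrame A).World))
  diam := fun X : Set (ultrafilterFrame A).World =>
    ({μ | ∃ ν, (ultrafilterFrame A).Rel μ ν ∧ ν ∈ X} : Set (ultrafilterFrame A).World)
  diam_bot := by
    apply Set.eq_empty_of_forall_notMem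
    rintro μ ⟨ν, -, h⟩
    exact h
  diam_sup := by
    intro X Y
    apply Set.ext
    intro μ
    constructor
    · rintro ⟨ν, hR, h | h⟩
      · exact Or.inl ⟨ν, hR, h⟩
      · exact Or.inr ⟨ν, hR, h⟩
    · rintro (⟨ν, hR, h⟩ | ⟨ν, hR, h⟩)
      · exact ⟨ν, hR, Or.inl h⟩
      · exact ⟨ν, hR, Or.inr h⟩

/-- The variety `V_L` is `κ`-canonical: it contains the canonical extension of each of its
`κ`-generated members. -/
def IsVarietyCanonicalInPower (L : Set (Formula ℕ)) (κ : Cardinal.{u}) : Prop :=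
  ∀ (A : Type u) [ModalAlgebra A], InVariety L A → IsGeneratedInPower A κ →
    InVariety L (CanonicalExtension A)

/-- The variety `V_L` is totally canonical: it contains the canonical extension of each of its
members. -/
def IsVarietyTotallyCanonical (L : Set (Formula ℕ)) : Prop :=
  ∀ (A : Type u) [ModalAlgebra A], InVariety L A → InVariety L (CanonicalExtension A)

end ModalLogic

namespace ModalLogic

open Formula

/-! ## Ultrafilters of modal algebras -/

section Ultrafilters

variable {A : Type u} [ModalAlgebra A]

/-! Suppose some `φ ∈ L` is refuted at an ultrafilter `γ` of an algebra `A` in the variety. Because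
`◇◇p → □◇p` is in `L`, each point at level `i` over `γ` sees exactly the points at level `i + 1`
(`rel_iff_mem_level`). Hence the truth of `◇ψ` at such a point depends only on `i` and `ψ`, and the
refutation is governed by countably many facts: which formulas are satisfied at which levels. One
witness per fact is enough.

Countably many elements of `A` then record all that matters (`exists_countable_reflecting`): they
separate the witnesses from each other and from the levels they miss, and they certify which finite
families of levels have empty intersection. If a homomorphism `h : B → A` has these elements in its
range, there is a map `f` from the ultrafilters of `B` to those of `A` that respects levels and
sends the trace on `B` of each witness back to that witness; compactness (`exists_mem_levels`)
supplies its other values. Pulling the valuation back along `f` refutes `φ` over `B`.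

Now let `B` be the Lindenbaum algebra over `ℕ`, with the atoms sent onto those elements
(`Lindenbaum.lift`). Its ultrafilter frame is isomorphic to the canonical frame of `L` over `ω`
atoms (`exists_equiv_canonicalFrame`), and the algebra itself is a countably generated member of
`V_L`. So either form of `ω`-canonicity excludes the refutation (`validates_ultrafilterFrame`). -/

theorem diam_mono : Monotone (ModalAlgebra.diam : A → A) := fun a b h => by
  rw [← sup_eq_right.2 h, ModalAlgebra.diam_sup]
  exact le_sup_left

theorem diam_iterate_bot (i : ℕ) : ModalAlgebra.diam^[i] (⊥ : A) = ⊥ :=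
  Function.iterate_fixed ModalAlgebra.diam_bot i

theorem diam_iterate_sup (i : ℕ) (a b : A) :
    ModalAlgebra.diam^[i] (a ⊔ b) = ModalAlgebra.diam^[i] a ⊔ ModalAlgebra.diam^[i] b := by
  induction i with
  | zero => rfl
  | succ i ih => simp only [Function.iterate_succ_apply', ih, ModalAlgebra.diam_sup]

namespace ultrafilterFrame

theorem bot_notMem (μ : (ultrafilterFrame A).World) : (⊥ : A) ∉ μ.1 := μ.2.1

theorem mem_of_le {μ : (ultrafilterFrame A).World} {a b : A} (h : a ≤ b) (ha : a ∈ μ.1) :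
    b ∈ μ.1 := Order.PFilter.mem_of_le h ha

theorem top_mem (μ : (ultrafilterFrame A).World) : (⊤ : A) ∈ μ.1 := Order.PFilter.top_mem

theorem inf_mem {μ : (ultrafilterFrame A).World} {a b : A} (ha : a ∈ μ.1) (hb : b ∈ μ.1) :
    a ⊓ b ∈ μ.1 := Order.PFilter.inf_mem ha hb

theorem compl_mem_iff {μ : (ultrafilterFrame A).World} {a : A} : aᶜ ∈ μ.1 ↔ a ∉ μ.1 := by
  constructor
  · intro h h'
    have := inf_mem h' h
    rw [inf_compl_eq_bot] at this
    exact bot_notMem μ this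
  · exact (μ.2.2 a).resolve_left

theorem sup_mem_iff {μ : (ultrafilterFrame A).World} {a b : A} :
    a ⊔ b ∈ μ.1 ↔ a ∈ μ.1 ∨ b ∈ μ.1 := by
  constructor
  · intro h
    by_contra! hc
    have := inf_mem h (inf_mem (compl_mem_iff.2 hc.1) (compl_mem_iff.2 hc.2))
    rw [← compl_sup, inf_compl_eq_bot] at this
    exact bot_notMem μ this
  · rintro (h | h)
    · exact mem_of_le le_sup_left h
    · exact mem_of_le le_sup_right h

theorem finset_inf_mem {ι : Type*} {μ : (ultrafilterFrame A).World} {s : Finset ι} {a : ι → A}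
    (h : ∀ i ∈ s, a i ∈ μ.1) : s.inf a ∈ μ.1 :=
  Finset.inf_induction (p := fun x => x ∈ μ.1) (top_mem μ) (fun _ h₁ _ h₂ => inf_mem h₁ h₂) h

theorem world_ext {μ ν : (ultrafilterFrame A).World} (h : ∀ a, a ∈ μ.1 → a ∈ ν.1) : μ = ν := by
  apply Subtype.ext
  apply SetLike.ext
  intro a
  refine ⟨h a, fun ha => ?_⟩
  by_contra hc
  exact compl_mem_iff.1 (h _ (compl_mem_iff.2 hc)) ha

/-- The ultrafilter with a given underlying set. -/
def mk (U : Set A) (top : ⊤ ∈ U) (inf : ∀ a ∈ U, ∀ b ∈ U, a ⊓ b ∈ U)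
    (up : ∀ a b, a ≤ b → a ∈ U → b ∈ U) (bot : ⊥ ∉ U) (total : ∀ a, a ∈ U ∨ aᶜ ∈ U) :
    (ultrafilterFrame A).World :=
  ⟨(Order.IsPFilter.of_def (F := U) ⟨⊤, top⟩
    (fun a ha b hb => ⟨a ⊓ b, inf a ha b hb, inf_le_left, inf_le_right⟩)
    (fun {a b} h ha => up a b h ha)).toPFilter, bot, total⟩

/-- The ultrafilter theorem. -/
theorem exists_world (U : Set A) (top : ⊤ ∈ U) (inf : ∀ a ∈ U, ∀ b ∈ U, a ⊓ b ∈ U)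
    (up : ∀ a b, a ≤ b → a ∈ U → b ∈ U) (bot : ⊥ ∉ U) :
    ∃ μ : (ultrafilterFrame A).World, ∀ a ∈ U, a ∈ μ.1 := by
  let F := (Order.IsPFilter.of_def (F := U) ⟨⊤, top⟩
    (fun a ha b hb => ⟨a ⊓ b, inf a ha b hb, inf_le_left, inf_le_right⟩)
    (fun {a b} h ha => up a b h ha)).toPFilter
  have hd : Disjoint (F : Set A) (Order.Ideal.principal (⊥ : A) : Set A) := by
    rw [Set.disjoint_left]
    intro a ha ha'
    rw [SetLike.mem_coe, Order.Ideal.mem_principal] at ha'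
    exact bot (up a ⊥ ha' ha)
  -- A prime ideal avoiding the filter; its complement is the required ultrafilter.
  obtain ⟨J, hJ, -, hJF⟩ := DistribLattice.prime_ideal_of_disjoint_filter_ideal hd
  have hbot : (⊥ : A) ∈ J := J.bot_mem
  refine ⟨mk {a | a ∉ J} ?_ ?_ ?_ ?_ ?_, ?_⟩
  · exact fun h => Set.disjoint_left.1 hJF top h
  · intro a ha b hb h
    exact (hJ.mem_or_mem h).elim ha hb
  · exact fun a b h ha hb => ha (J.lower h hb)
  · exact fun h => h hbot
  · intro a
    by_contra! hc
    simp only [Set.mem_ofPred_eq, not_not] at hc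
    have := Order.Ideal.sup_mem hc.1 hc.2
    rw [sup_compl_eq_top] at this
    exact Set.disjoint_left.1 hJF top this
  · exact fun a ha h => Set.disjoint_left.1 hJF ha h

end ultrafilterFrame

/-- The inverse image of an ultrafilter under a homomorphism. -/
def ultrafilterFrame.comap {B : Type v} [ModalAlgebra B] (h : BoundedLatticeHom B A)
    (μ : (ultrafilterFrame A).World) : (ultrafilterFrame B).World :=
  ultrafilterFrame.mk {b | h b ∈ μ.1}
    (by simp)
    (fun a ha b hb => by
      simp only [Set.mem_ofPred_eq, map_inf] at *
      exact ultrafilterFrame.inf_mem ha hb)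
    (fun a b hab ha => ultrafilterFrame.mem_of_le (OrderHomClass.mono h hab) ha)
    (by simpa using ultrafilterFrame.bot_notMem μ)
    (fun a => by simpa only [Set.mem_ofPred_eq, map_compl'] using μ.2.2 (h a))

theorem ultrafilterFrame.mem_comap {B : Type v} [ModalAlgebra B] {h : BoundedLatticeHom B A}
    {μ : (ultrafilterFrame A).World} {b : B} :
    b ∈ (ultrafilterFrame.comap h μ).1 ↔ h b ∈ μ.1 := Iff.rfl

/-! ## Levels of a point -/

/-- The set of points reachable from `γ` in `i` steps, described algebraically. -/
def level (γ : (ultrafilterFrame A).World) (i : ℕ) : Set (ultrafilterFrame A).World :=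
  {μ | ∀ a ∈ μ.1, ModalAlgebra.diam^[i] a ∈ γ.1}

theorem mem_level_zero {γ μ : (ultrafilterFrame A).World} : μ ∈ level γ 0 ↔ μ = γ :=
  ⟨fun h => ultrafilterFrame.world_ext h, fun h => by subst h; exact fun _ ha => ha⟩

/-- The axiom propagated along iterates: by induction `◇^i ¬◇a` lies below `¬◇^(i+1) a`, and `h52`
applied to `◇^i a` gives the next case. -/
theorem disjoint_diam_iterate (h52 : ∀ a : A, Disjoint (ModalAlgebra.diam (ModalAlgebra.diam a))
    (ModalAlgebra.diam (ModalAlgebra.diam a)ᶜ)) (i : ℕ) (a : A) :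
    Disjoint (ModalAlgebra.diam^[i + 1] a) (ModalAlgebra.diam^[i] (ModalAlgebra.diam a)ᶜ) := by
  induction i with
  | zero => exact disjoint_compl_right
  | succ i ih =>
    rw [Function.iterate_succ_apply', Function.iterate_succ_apply' _ i,
      Function.iterate_succ_apply' _ i]
    refine (h52 _).mono_right (diam_mono ?_)
    rw [← Function.iterate_succ_apply' ModalAlgebra.diam i a]
    exact ih.symm.le_compl_right

/-- The decisive consequence of the axiom: the successors of a point depend only on a level
containing it. If `◇a` failed at `μ`, then `γ` would contain both `◇^(i+1) a` and `◇^i ¬◇a`, which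
are disjoint. -/
theorem rel_iff_mem_level (h52 : ∀ a : A, Disjoint (ModalAlgebra.diam (ModalAlgebra.diam a))
    (ModalAlgebra.diam (ModalAlgebra.diam a)ᶜ)) {γ μ ν : (ultrafilterFrame A).World} {i : ℕ}
    (hμ : μ ∈ level γ i) : (ultrafilterFrame A).Rel μ ν ↔ ν ∈ level γ (i + 1) := by
  constructor
  · intro h a ha
    rw [Function.iterate_succ_apply]
    exact hμ _ (h a ha)
  · intro h a ha
    by_contra hc
    have h₁ := h a ha
    have h₂ := hμ _ (ultrafilterFrame.compl_mem_iff.2 hc)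
    have h₃ := ultrafilterFrame.inf_mem h₁ h₂
    rw [(disjoint_diam_iterate h52 i a).eq_bot] at h₃
    exact ultrafilterFrame.bot_notMem γ h₃

/-- The elements containing all of level `i` of `γ`. -/
def levelNhds (γ : (ultrafilterFrame A).World) (i : ℕ) : Set A :=
  {a | ModalAlgebra.diam^[i] aᶜ ∉ γ.1}

theorem levelNhds_top (γ : (ultrafilterFrame A).World) (i : ℕ) : (⊤ : A) ∈ levelNhds γ i := by
  simpa [levelNhds, diam_iterate_bot] using ultrafilterFrame.bot_notMem γ

theorem levelNhds_inf {γ : (ultrafilterFrame A).World} {i : ℕ} {a b : A}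
    (ha : a ∈ levelNhds γ i) (hb : b ∈ levelNhds γ i) : a ⊓ b ∈ levelNhds γ i := by
  simp only [levelNhds, Set.mem_ofPred_eq, compl_inf, diam_iterate_sup,
    ultrafilterFrame.sup_mem_iff, not_or] at *
  exact ⟨ha, hb⟩

theorem mem_of_mem_levelNhds {γ μ : (ultrafilterFrame A).World} {i : ℕ} {a : A}
    (ha : a ∈ levelNhds γ i) (hμ : μ ∈ level γ i) : a ∈ μ.1 := by
  by_contra hc
  exact ha (hμ _ (ultrafilterFrame.compl_mem_iff.2 hc))

/-- Compactness for intersections of levels. -/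
theorem exists_mem_levels (γ : (ultrafilterFrame A).World) (J : Set ℕ)
    (hJ : ∀ (I : Finset ℕ) (a : ℕ → A), (∀ i ∈ I, i ∈ J) → (∀ i, a i ∈ levelNhds γ i) →
      I.inf a ≠ ⊥) :
    ∃ μ, ∀ i ∈ J, μ ∈ level γ i := by
  -- The filter generated by the neighbourhoods of all levels in `J`; `hJ` is exactly its
  -- properness.
  obtain ⟨μ, hμ⟩ := ultrafilterFrame.exists_world
    {s : A | ∃ (I : Finset ℕ) (a : ℕ → A), (∀ i ∈ I, i ∈ J) ∧ (∀ i, a i ∈ levelNhds γ i) ∧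
      I.inf a ≤ s}
    ⟨∅, fun _ => ⊤, by simp, levelNhds_top γ, le_top⟩
    (by
      rintro s ⟨I, a, hI, ha, hs⟩ t ⟨I', a', hI', ha', ht⟩
      refine ⟨I ∪ I', fun i => a i ⊓ a' i, ?_, fun i => levelNhds_inf (ha i) (ha' i), ?_⟩
      · intro i hi
        exact (Finset.mem_union.1 hi).elim (hI i) (hI' i)
      · refine le_inf (le_trans ?_ hs) (le_trans ?_ ht)
        · exact Finset.le_inf fun i hi =>
            (Finset.inf_le (Finset.mem_union_left _ hi)).trans inf_le_left
        · exact Finset.le_inf fun i hi =>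
            (Finset.inf_le (Finset.mem_union_right _ hi)).trans inf_le_right)
    (fun s t hst ⟨I, a, hI, ha, hs⟩ => ⟨I, a, hI, ha, hs.trans hst⟩)
    (fun ⟨I, a, hI, ha, hs⟩ => hJ I a hI ha (le_bot_iff.1 hs))
  refine ⟨μ, fun i hi a ha => ?_⟩
  by_contra hc
  -- If `◇^i a ∉ γ`, then `aᶜ` is itself a neighbourhood of level `i`, so it lies in the filter.
  refine ultrafilterFrame.compl_mem_iff.1
    (hμ aᶜ ⟨{i}, fun j => if j = i then aᶜ else ⊤, ?_, ?_, ?_⟩) ha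
  · simpa using hi
  · intro j
    by_cases hj : j = i
    · subst hj
      simpa [levelNhds] using hc
    · simpa [hj] using levelNhds_top γ j
  · simp

end Ultrafilters

/-! ## Countability of the set of formulas -/

/-- An injective coding of formulas by natural numbers. -/
def Formula.code : Formula ℕ → ℕ
  | atom n => Nat.pair 0 n
  | verum => Nat.pair 1 0
  | neg φ => Nat.pair 2 (code φ)
  | disj φ ψ => Nat.pair 3 (Nat.pair (code φ) (code ψ))
  | dia φ => Nat.pair 4 (code φ)

theorem Formula.code_injective : Function.Injective Formula.code := by
  intro φ
  induction φ with
  | atom n => intro ψ h; cases ψ <;> simp_all [code, Nat.pair_eq_pair]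
  | verum => intro ψ h; cases ψ <;> simp_all [code, Nat.pair_eq_pair]
  | neg φ ih =>
    intro ψ h
    cases ψ <;> simp [code, Nat.pair_eq_pair] at h
    rw [ih h]
  | disj φ χ ih₁ ih₂ =>
    intro ψ h
    cases ψ <;> simp [code, Nat.pair_eq_pair] at h
    rw [ih₁ h.1, ih₂ h.2]
  | dia φ ih =>
    intro ψ h
    cases ψ <;> simp [code, Nat.pair_eq_pair] at h
    rw [ih h]

instance : Countable (Formula ℕ) := Formula.code_injective.countable

/-! ## Reflection of refutations along homomorphisms -/

/-- A formula refuted in the canonical frame of a modal algebra satisfying `◇◇a ≤ □◇a` is refuted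
in the canonical frame of every such algebra having a homomorphism whose range contains certain
countably many elements. -/
theorem exists_countable_reflecting {A : Type u} [ModalAlgebra A]
    (h52 : ∀ a : A, Disjoint (ModalAlgebra.diam (ModalAlgebra.diam a))
      (ModalAlgebra.diam (ModalAlgebra.diam a)ᶜ))
    (g : ℕ → Set (ultrafilterFrame A).World) (γ : (ultrafilterFrame A).World) (φ : Formula ℕ)
    (hφ : ¬ (ultrafilterFrame A).Sat g γ φ) :
    ∃ G : Set A, G.Countable ∧ ∀ (B : Type v) [ModalAlgebra B],
      (∀ b : B, Disjoint (ModalAlgebra.diam (ModalAlgebra.diam b))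
        (ModalAlgebra.diam (ModalAlgebra.diam b)ᶜ)) →
      ∀ h : BoundedLatticeHom B A, (∀ b, h (ModalAlgebra.diam b) = ModalAlgebra.diam (h b)) →
      G ⊆ Set.range h →
      ∃ (g' : ℕ → Set (ultrafilterFrame B).World) (γ' : (ultrafilterFrame B).World),
        ¬ (ultrafilterFrame B).Sat g' γ' φ := by
  classical
  -- One witness for each pair of a level and a formula; the default `γ` is a dummy for unsatisfied
  -- pairs.
  have hz : ∀ k : ℕ × Formula ℕ, ∃ μ : (ultrafilterFrame A).World,
      (∃ ν ∈ level γ k.1, (ultrafilterFrame A).Sat g ν k.2) →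
        μ ∈ level γ k.1 ∧ (ultrafilterFrame A).Sat g μ k.2 := by
    intro k
    by_cases hk : ∃ ν ∈ level γ k.1, (ultrafilterFrame A).Sat g ν k.2
    · obtain ⟨ν, hν⟩ := hk
      exact ⟨ν, fun _ => hν⟩
    · exact ⟨γ, fun h => absurd h hk⟩
  choose z hz using hz
  have hs : ∀ k l : ℕ × Formula ℕ, ∃ a : A, z k ≠ z l → a ∈ (z k).1 ∧ a ∉ (z l).1 := by
    intro k l
    by_contra! hc
    exact (hc ⊥).1 (ultrafilterFrame.world_ext fun a ha => (hc a).2 ha)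
  choose s hs using hs
  have ht : ∀ (k : ℕ × Formula ℕ) (i : ℕ), ∃ a : A, z k ∉ level γ i →
      a ∈ (z k).1 ∧ ModalAlgebra.diam^[i] a ∉ γ.1 := by
    intro k i
    by_contra! hc
    exact (hc ⊥).1 fun a ha => (hc a).2 ha
  choose t ht using ht
  -- For each finite set of levels, neighbourhoods with zero meet are fixed whenever any exist.
  have hw : ∀ I : Finset ℕ, ∃ a : ℕ → A, (∀ i, a i ∈ levelNhds γ i) ∧
      ((∃ b : ℕ → A, (∀ i, b i ∈ levelNhds γ i) ∧ I.inf b = ⊥) → I.inf a = ⊥) := by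
    intro I
    by_cases hI : ∃ b : ℕ → A, (∀ i, b i ∈ levelNhds γ i) ∧ I.inf b = ⊥
    · obtain ⟨b, hb, hb'⟩ := hI
      exact ⟨b, hb, fun _ => hb'⟩
    · exact ⟨fun _ => ⊤, levelNhds_top γ, fun h => absurd h hI⟩
  choose w hw hw' using hw
  refine ⟨Set.range (fun p : (ℕ × Formula ℕ) × (ℕ × Formula ℕ) => s p.1 p.2) ∪
    Set.range (fun p : (ℕ × Formula ℕ) × ℕ => t p.1 p.2) ∪
    Set.range (fun p : Finset ℕ × ℕ => w p.1 p.2),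
    ((Set.countable_range _).union (Set.countable_range _)).union (Set.countable_range _), ?_⟩
  intro B _ hB h hdia hG
  have hiter : ∀ (i : ℕ) (b : B), h (ModalAlgebra.diam^[i] b) = ModalAlgebra.diam^[i] (h b) :=
    fun i b => (Function.Semiconj.iterate_right (f := h) hdia i) b
  have hGs : ∀ k l, ∃ b, h b = s k l := fun k l => hG (Or.inl (Or.inl ⟨(k, l), rfl⟩))
  have hGt : ∀ k i, ∃ b, h b = t k i := fun k i => hG (Or.inl (Or.inr ⟨(k, i), rfl⟩))
  have hGw : ∀ I i, ∃ b, h b = w I i := fun I i => hG (Or.inr ⟨(I, i), rfl⟩)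
  set γ' := ultrafilterFrame.comap h γ with hγ'
  have hcomap : ∀ {μ i}, μ ∈ level γ i → ultrafilterFrame.comap h μ ∈ level γ' i := by
    intro μ i hμ b hb
    rw [hγ', ultrafilterFrame.mem_comap, hiter]
    exact hμ _ hb
  -- The ultrafilter `x` may satisfy several level conditions at once, and its image has to satisfy
  -- all of them.
  have hf : ∀ x : (ultrafilterFrame B).World, ∃ y : (ultrafilterFrame A).World,
      (∀ i, x ∈ level γ' i → y ∈ level γ i) ∧
      ∀ k, x = ultrafilterFrame.comap h (z k) → y = z k := by
    intro x
    by_cases hx : ∃ k, x = ultrafilterFrame.comap h (z k)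
    · obtain ⟨k, rfl⟩ := hx
      refine ⟨z k, fun i hi => ?_, fun l hl => ?_⟩
      · by_contra hc
        obtain ⟨h₁, h₂⟩ := ht k i hc
        obtain ⟨b, hb⟩ := hGt k i
        rw [← hb] at h₁ h₂
        rw [← hiter] at h₂
        exact h₂ (hi b h₁)
      · by_contra hc
        obtain ⟨h₁, h₂⟩ := hs k l hc
        obtain ⟨b, hb⟩ := hGs k l
        rw [← hb] at h₁ h₂
        rw [← ultrafilterFrame.mem_comap] at h₁ h₂
        rw [hl] at h₁
        exact h₂ h₁
    -- If the levels were incompatible in `A`, the chosen `w I` would lift to elements of `B` whose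
    -- meet lies in `x` but is killed by `h`. For `i ∈ I`, membership of `x` in level `i` would then
    -- put `◇^i ⊥ = ⊥` into `γ`.
    · obtain ⟨y, hy⟩ := exists_mem_levels γ {i | x ∈ level γ' i} (by
        intro I a hI ha hbot
        have hw₁ := hw' I ⟨a, ha, hbot⟩
        choose b hb using hGw I
        have hbx : I.inf b ∈ x.1 := ultrafilterFrame.finset_inf_mem fun i hi => by
          refine mem_of_mem_levelNhds (γ := γ') (i := i) ?_ (hI i hi)
          have := hw I i
          rw [← hb] at this
          intro hc
          rw [hγ', ultrafilterFrame.mem_comap, hiter, map_compl'] at hc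
          exact this hc
        have hhb : h (I.inf b) = ⊥ := by
          rw [map_finset_inf, ← hw₁]
          exact Finset.inf_congr rfl fun i _ => hb i
        -- With no index available, the empty meet gives `⊤ = ⊥` in `A`.
        obtain rfl | ⟨i, hi⟩ := I.eq_empty_or_nonempty
        · rw [Finset.inf_empty] at hbot
          have := ultrafilterFrame.top_mem γ
          rw [hbot] at this
          exact ultrafilterFrame.bot_notMem γ this
        · have := hI i hi _ hbx
          rw [hγ', ultrafilterFrame.mem_comap, hiter, hhb, diam_iterate_bot] at this
          exact ultrafilterFrame.bot_notMem γ this)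
      exact ⟨y, hy, fun k hk => absurd ⟨k, hk⟩ hx⟩
  choose f hf hfz using hf
  have key : ∀ (ψ : Formula ℕ) (i : ℕ) (x : (ultrafilterFrame B).World), x ∈ level γ' i →
      ((ultrafilterFrame B).Sat (fun p => f ⁻¹' g p) x ψ ↔ (ultrafilterFrame A).Sat g (f x) ψ) := by
    intro ψ
    induction ψ with
    | atom p => exact fun i x _ => Iff.rfl
    | verum => exact fun i x _ => Iff.rfl
    | neg ψ ih => exact fun i x hx => not_congr (ih i x hx)
    | disj ψ χ ih₁ ih₂ => exact fun i x hx => or_congr (ih₁ i x hx) (ih₂ i x hx)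
    | dia ψ ih =>
      intro i x hx
      constructor
      · rintro ⟨y, hxy, hy⟩
        rw [rel_iff_mem_level hB hx] at hxy
        exact ⟨f y, (rel_iff_mem_level h52 (hf x i hx)).2 (hf y _ hxy), (ih _ y hxy).1 hy⟩
      · rintro ⟨ν, hν, hsat⟩
        rw [rel_iff_mem_level h52 (hf x i hx)] at hν
        -- The successor `ν` need not be in the range of `f`, so it is exchanged for the chosen
        -- witness at the same level, which is.
        obtain ⟨h₁, h₂⟩ := hz (i + 1, ψ) ⟨ν, hν, hsat⟩
        have h₃ := hcomap h₁
        refine ⟨_, (rel_iff_mem_level hB hx).2 h₃, (ih _ _ h₃).2 ?_⟩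
        rw [hfz _ (i + 1, ψ) rfl]
        exact h₂
  have hγ₀ : γ' ∈ level γ' 0 := mem_level_zero.2 rfl
  refine ⟨fun p => f ⁻¹' g p, γ', ?_⟩
  rw [key φ 0 γ' hγ₀, mem_level_zero.1 (hf γ' 0 hγ₀)]
  exact hφ

/-! ## Theorems over an arbitrary set of atoms -/

/-- Truth assignments respecting the propositional connectives. -/
structure IsAssignment {α : Type u} (w : Formula α → Prop) : Prop where
  verum : w verum
  neg : ∀ ψ, w (neg ψ) ↔ ¬ w ψ
  disj : ∀ ψ χ, w (disj ψ χ) ↔ (w ψ ∨ w χ)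

namespace IsAssignment

variable {α : Type u} {w : Formula α → Prop}

theorem imp (h : IsAssignment w) (φ ψ : Formula α) : w (imp φ ψ) ↔ (w φ → w ψ) := by
  rw [Formula.imp, h.disj, h.neg, imp_iff_not_or]

theorem conj (h : IsAssignment w) (φ ψ : Formula α) : w (conj φ ψ) ↔ (w φ ∧ w ψ) := by
  rw [Formula.conj, h.neg, h.disj, h.neg, h.neg, not_or, not_not, not_not]

theorem falsum (h : IsAssignment w) : ¬ w falsum := by
  rw [Formula.falsum, h.neg, not_not]
  exact h.verum

theorem listConj (h : IsAssignment w) (l : List (Formula α)) :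
    w (listConj l) ↔ ∀ φ ∈ l, w φ := by
  induction l with
  | nil => simpa [Formula.listConj] using h.verum
  | cons φ l ih => simp [Formula.listConj, h.conj, ih]

end IsAssignment

theorem Formula.subst_subst {α β : Type*} {γ : Type*} (σ : α → Formula β) (τ : β → Formula γ)
    (φ : Formula α) : (φ.subst σ).subst τ = φ.subst fun a => (σ a).subst τ := by
  induction φ with
  | atom a => rfl
  | verum => rfl
  | neg φ ih => simp only [subst, ih]
  | disj φ ψ ih₁ ih₂ => simp only [subst, ih₁, ih₂]
  | dia φ ih => simp only [subst, ih]

/-- A substitution has an inverse on any given formula if it renames atoms injectively there. -/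
theorem Formula.exists_renaming {α : Type u} (φ : Formula α) :
    ∃ (ρ : α → ℕ) (τ : ℕ → Formula α), (φ.subst fun a => atom (ρ a)).subst τ = φ := by
  classical
  -- Only finitely many atoms matter, so they can be renamed injectively into `ℕ`.
  have hfin : ∃ s : Finset α, ∀ σ : α → Formula α, (∀ a ∈ s, σ a = atom a) → φ.subst σ = φ := by
    induction φ with
    | atom a => exact ⟨{a}, fun σ h => h a (Finset.mem_singleton_self a)⟩
    | verum => exact ⟨∅, fun σ _ => rfl⟩
    | neg φ ih =>
      obtain ⟨s, hs⟩ := ih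
      exact ⟨s, fun σ h => by rw [subst, hs σ h]⟩
    | disj φ ψ ih₁ ih₂ =>
      obtain ⟨s, hs⟩ := ih₁
      obtain ⟨t, ht⟩ := ih₂
      exact ⟨s ∪ t, fun σ h => by
        rw [subst, hs σ fun a ha => h a (Finset.mem_union_left _ ha),
          ht σ fun a ha => h a (Finset.mem_union_right _ ha)]⟩
    | dia φ ih =>
      obtain ⟨s, hs⟩ := ih
      exact ⟨s, fun σ h => by rw [subst, hs σ h]⟩
  obtain ⟨s, hs⟩ := hfin
  obtain ⟨ρ, hρ⟩ := Set.countable_iff_exists_injOn.1 s.countable_toSet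
  refine ⟨ρ, fun n => if h : ∃ a ∈ s, ρ a = n then atom h.choose else verum, ?_⟩
  rw [subst_subst]
  refine hs _ fun a ha => ?_
  have h : ∃ b ∈ s, ρ b = ρ a := ⟨a, ha, rfl⟩
  rw [subst, dif_pos h]
  congr 1
  exact hρ h.choose_spec.1 ha h.choose_spec.2

section Theorems

variable {L : Set (Formula ℕ)} {α : Type u}

/-- Two theorems over `α` may be instances of members of `L` under unrelated substitutions.
Quantifying over all substitutions back into `ℕ` makes the closure properties immediate;
`exists_renaming` gives the converse. -/
theorem mem_theoremsOver (hL : IsNormalLogic L) {φ : Formula α} :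
    φ ∈ theoremsOver L α ↔ ∀ σ : α → Formula ℕ, φ.subst σ ∈ L := by
  constructor
  · rintro ⟨ψ, hψ, σ, rfl⟩ τ
    rw [subst_subst]
    exact hL.substitution ψ _ hψ
  · intro h
    obtain ⟨ρ, τ, hρ⟩ := φ.exists_renaming
    exact ⟨_, h _, τ, hρ.symm⟩

theorem theoremsOver_modusPonens (hL : IsNormalLogic L) {φ ψ : Formula α}
    (h₁ : φ ∈ theoremsOver L α) (h₂ : imp φ ψ ∈ theoremsOver L α) : ψ ∈ theoremsOver L α := by
  rw [mem_theoremsOver hL] at *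
  exact fun σ => hL.modusPonens _ _ (h₁ σ) (h₂ σ)

theorem theoremsOver_generalisation (hL : IsNormalLogic L) {φ : Formula α}
    (h : φ ∈ theoremsOver L α) : box φ ∈ theoremsOver L α := by
  rw [mem_theoremsOver hL] at *
  exact fun σ => hL.generalisation _ (h σ)

theorem theoremsOver_of_valid (hL : IsNormalLogic L) {φ : Formula α}
    (h : ∀ w, IsAssignment w → w φ) : φ ∈ theoremsOver L α := by
  rw [mem_theoremsOver hL]
  refine fun σ => hL.taut _ fun w h₁ h₂ h₃ => h (fun ψ => w (ψ.subst σ)) ⟨h₁, ?_, ?_⟩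
  · exact fun ψ => h₂ _
  · exact fun ψ χ => h₃ _ _

theorem theoremsOver_of_entails (hL : IsNormalLogic L) {φ ψ : Formula α}
    (h₁ : φ ∈ theoremsOver L α) (h : ∀ w, IsAssignment w → w φ → w ψ) :
    ψ ∈ theoremsOver L α :=
  theoremsOver_modusPonens hL h₁
    (theoremsOver_of_valid hL fun w hw => (hw.imp φ ψ).2 (h w hw))

theorem theoremsOver_of_entails₂ (hL : IsNormalLogic L) {φ ψ χ : Formula α}
    (h₁ : φ ∈ theoremsOver L α) (h₂ : ψ ∈ theoremsOver L α)
    (h : ∀ w, IsAssignment w → w φ → w ψ → w χ) : χ ∈ theoremsOver L α :=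
  theoremsOver_modusPonens hL h₂
    (theoremsOver_of_entails hL h₁ fun w hw hφ => (hw.imp ψ χ).2 (h w hw hφ))

theorem theoremsOver_axiomK (hL : IsNormalLogic L) (φ ψ : Formula α) :
    imp (box (imp φ ψ)) (imp (box φ) (box ψ)) ∈ theoremsOver L α :=
  ⟨_, hL.axiomK, fun i => if i = 0 then φ else ψ, rfl⟩

/-- Boxes distribute over provable implications. -/
theorem theoremsOver_box_mono (hL : IsNormalLogic L) {φ ψ : Formula α}
    (h : imp φ ψ ∈ theoremsOver L α) : imp (box φ) (box ψ) ∈ theoremsOver L α :=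
  theoremsOver_modusPonens hL (theoremsOver_generalisation hL h) (theoremsOver_axiomK hL φ ψ)

end Theorems

/-- `◇φ` and `¬□¬φ` are provably equivalent. -/
theorem theoremsOver_dual {L : Set (Formula ℕ)} (hL : IsNormalLogic L) {α : Type u}
    (φ : Formula α) : equiv (dia φ) (neg (box (neg φ))) ∈ theoremsOver L α :=
  ⟨_, hL.axiomDual, fun _ => φ, rfl⟩

/-- Diamonds are monotone for provable implication. -/
theorem theoremsOver_dia_mono {L : Set (Formula ℕ)} (hL : IsNormalLogic L) {α : Type u}
    {φ ψ : Formula α} (h : imp φ ψ ∈ theoremsOver L α) :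
    imp (dia φ) (dia ψ) ∈ theoremsOver L α := by
  -- Generalisation and K concern `□`, which abbreviates `¬◇¬`; the dual axiom is what removes the
  -- double negations under `◇`.
  have h₁ : imp (neg ψ) (neg φ) ∈ theoremsOver L α :=
    theoremsOver_of_entails hL h fun w hw => by
      rw [hw.imp, hw.imp, hw.neg, hw.neg]
      exact mt
  have h₂ := theoremsOver_of_entails₂ hL (theoremsOver_dual hL φ) (theoremsOver_box_mono hL h₁)
    (χ := imp (dia φ) (neg (box (neg ψ)))) fun w hw => by
      simp only [equiv, hw.conj, hw.imp, hw.neg]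
      tauto
  exact theoremsOver_of_entails₂ hL h₂ (theoremsOver_dual hL ψ) fun w hw => by
      simp only [equiv, hw.conj, hw.imp, hw.neg]
      tauto

/-- Diamonds distribute over disjunctions. -/
theorem theoremsOver_dia_disj {L : Set (Formula ℕ)} (hL : IsNormalLogic L) {α : Type u}
    (φ ψ : Formula α) : imp (dia (disj φ ψ)) (disj (dia φ) (dia ψ)) ∈ theoremsOver L α := by
  have h₁ : imp (neg φ) (imp (neg ψ) (neg (disj φ ψ))) ∈ theoremsOver L α :=
    theoremsOver_of_valid hL fun w hw => by
      simp only [hw.imp, hw.neg, hw.disj]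
      tauto
  have h₂ := theoremsOver_of_entails₂ hL (theoremsOver_box_mono hL h₁)
    (theoremsOver_axiomK hL (neg ψ) (neg (disj φ ψ)))
    (χ := imp (box (neg φ)) (imp (box (neg ψ)) (box (neg (disj φ ψ))))) fun w hw => by
      simp only [hw.imp]
      tauto
  have h₃ := theoremsOver_of_entails₂ hL (theoremsOver_dual hL φ) (theoremsOver_dual hL ψ)
    (χ := imp (neg (disj (dia φ) (dia ψ))) (conj (box (neg φ)) (box (neg ψ)))) fun w hw => by
      simp only [equiv, hw.conj, hw.imp, hw.neg, hw.disj]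
      tauto
  have h₄ := theoremsOver_of_entails₂ hL h₂ h₃
    (χ := imp (neg (disj (dia φ) (dia ψ))) (box (neg (disj φ ψ)))) fun w hw => by
      simp only [hw.conj, hw.imp]
      tauto
  exact theoremsOver_of_entails₂ hL h₄ (theoremsOver_dual hL (disj φ ψ)) fun w hw => by
      simp only [equiv, hw.conj, hw.imp, hw.neg]
      tauto

theorem theoremsOver_neg_dia_falsum {L : Set (Formula ℕ)} (hL : IsNormalLogic L) {α : Type u} :
    neg (dia (falsum : Formula α)) ∈ theoremsOver L α :=
  theoremsOver_of_entails₂ hL (theoremsOver_dual hL falsum)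
    (theoremsOver_generalisation hL (φ := neg falsum)
      (theoremsOver_of_valid hL fun w hw => (hw.neg _).2 hw.falsum)) fun w hw => by
      simp only [equiv, hw.conj, hw.imp, hw.neg]
      tauto

/-! ## Lindenbaum algebras -/

/-- Provable equivalence. -/
def provableSetoid {L : Set (Formula ℕ)} (hL : IsNormalLogic L) (α : Type u) :
    Setoid (Formula α) where
  r φ ψ := imp φ ψ ∈ theoremsOver L α ∧ imp ψ φ ∈ theoremsOver L α
  iseqv :=
    { refl := fun φ =>
        have h : imp φ φ ∈ theoremsOver L α :=
          theoremsOver_of_valid hL fun w hw => (hw.imp φ φ).2 id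
        ⟨h, h⟩
      symm := And.symm
      trans := fun {φ ψ χ} h₁ h₂ =>
        have t : ∀ {φ ψ χ : Formula α}, imp φ ψ ∈ theoremsOver L α →
            imp ψ χ ∈ theoremsOver L α → imp φ χ ∈ theoremsOver L α := fun h₁ h₂ =>
          theoremsOver_of_entails₂ hL h₁ h₂ fun w hw => by
            simp only [hw.imp]
            tauto
        ⟨t h₁.1 h₂.1, t h₂.2 h₁.2⟩ }

/-- The Lindenbaum algebra of `L` over `α`. -/
def Lindenbaum {L : Set (Formula ℕ)} (hL : IsNormalLogic L) (α : Type u) : Type u :=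
  Quotient (provableSetoid hL α)

namespace Lindenbaum

variable {L : Set (Formula ℕ)} {hL : IsNormalLogic L} {α : Type u}

/-- The class of a formula. -/
def cls (hL : IsNormalLogic L) (φ : Formula α) : Lindenbaum hL α :=
  Quotient.mk (provableSetoid hL α) φ

theorem exists_cls (a : Lindenbaum hL α) : ∃ φ, cls hL φ = a := Quotient.exists_rep a

instance : LE (Lindenbaum hL α) where
  le := Quotient.lift₂ (fun φ ψ => imp φ ψ ∈ theoremsOver L α) (by
    have t : ∀ {φ ψ φ' ψ' : Formula α}, imp φ' φ ∈ theoremsOver L α →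
        imp ψ ψ' ∈ theoremsOver L α → imp φ ψ ∈ theoremsOver L α →
        imp φ' ψ' ∈ theoremsOver L α := fun {φ ψ φ' ψ'} h₁ h₂ h₃ => by
      have h₄ : imp φ' ψ ∈ theoremsOver L α := theoremsOver_of_entails₂ hL h₁ h₃ fun w hw => by
        simp only [hw.imp]
        tauto
      exact theoremsOver_of_entails₂ hL h₄ h₂ fun w hw => by
        simp only [hw.imp]
        tauto
    exact fun φ ψ φ' ψ' h₁ h₂ => propext ⟨t h₁.2 h₂.1, t h₁.1 h₂.2⟩)

theorem cls_le_cls {φ ψ : Formula α} :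
    cls hL φ ≤ cls hL ψ ↔ imp φ ψ ∈ theoremsOver L α := Iff.rfl

theorem cls_eq_cls {φ ψ : Formula α} :
    cls hL φ = cls hL ψ ↔ imp φ ψ ∈ theoremsOver L α ∧ imp ψ φ ∈ theoremsOver L α :=
  Quotient.eq (r := provableSetoid hL α)

theorem cls_le_of_valid {φ ψ : Formula α} (h : ∀ w, IsAssignment w → w φ → w ψ) :
    cls hL φ ≤ cls hL ψ :=
  theoremsOver_of_valid hL fun w hw => (hw.imp φ ψ).2 (h w hw)

instance : BooleanAlgebra (Lindenbaum hL α) where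
  le := (· ≤ ·)
  le_refl a := by
    obtain ⟨φ, rfl⟩ := exists_cls a
    exact cls_le_of_valid fun _ _ => id
  le_trans a b c h₁ h₂ := by
    obtain ⟨φ, rfl⟩ := exists_cls a
    obtain ⟨ψ, rfl⟩ := exists_cls b
    obtain ⟨χ, rfl⟩ := exists_cls c
    exact theoremsOver_of_entails₂ hL h₁ h₂ fun w hw => by
      simp only [hw.imp]
      tauto
  le_antisymm a b h₁ h₂ := by
    obtain ⟨φ, rfl⟩ := exists_cls a
    obtain ⟨ψ, rfl⟩ := exists_cls b
    exact cls_eq_cls.2 ⟨h₁, h₂⟩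
  sup := Quotient.lift₂ (fun φ ψ => cls hL (disj φ ψ)) (by
    have t : ∀ {φ ψ φ' ψ' : Formula α}, imp φ φ' ∈ theoremsOver L α →
        imp ψ ψ' ∈ theoremsOver L α → imp (disj φ ψ) (disj φ' ψ') ∈ theoremsOver L α :=
      fun h₁ h₂ => theoremsOver_of_entails₂ hL h₁ h₂ fun w hw => by
        simp only [hw.imp, hw.disj]
        tauto
    exact fun φ ψ φ' ψ' h₁ h₂ => cls_eq_cls.2 ⟨t h₁.1 h₂.1, t h₁.2 h₂.2⟩)
  inf := Quotient.lift₂ (fun φ ψ => cls hL (conj φ ψ)) (by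
    have t : ∀ {φ ψ φ' ψ' : Formula α}, imp φ φ' ∈ theoremsOver L α →
        imp ψ ψ' ∈ theoremsOver L α → imp (conj φ ψ) (conj φ' ψ') ∈ theoremsOver L α :=
      fun h₁ h₂ => theoremsOver_of_entails₂ hL h₁ h₂ fun w hw => by
        simp only [hw.imp, hw.conj]
        tauto
    exact fun φ ψ φ' ψ' h₁ h₂ => cls_eq_cls.2 ⟨t h₁.1 h₂.1, t h₁.2 h₂.2⟩)
  compl := Quotient.lift (fun φ => cls hL (neg φ)) (by
    have t : ∀ {φ φ' : Formula α}, imp φ φ' ∈ theoremsOver L α →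
        imp (neg φ') (neg φ) ∈ theoremsOver L α :=
      fun h => theoremsOver_of_entails hL h fun w hw => by
        simp only [hw.imp, hw.neg]
        tauto
    exact fun φ φ' h => cls_eq_cls.2 ⟨t h.2, t h.1⟩)
  top := cls hL verum
  bot := cls hL falsum
  le_sup_left a b := by
    obtain ⟨φ, rfl⟩ := exists_cls a
    obtain ⟨ψ, rfl⟩ := exists_cls b
    exact cls_le_of_valid fun w hw h => (hw.disj _ _).2 (Or.inl h)
  le_sup_right a b := by
    obtain ⟨φ, rfl⟩ := exists_cls a
    obtain ⟨ψ, rfl⟩ := exists_cls b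
    exact cls_le_of_valid fun w hw h => (hw.disj _ _).2 (Or.inr h)
  sup_le a b c h₁ h₂ := by
    obtain ⟨φ, rfl⟩ := exists_cls a
    obtain ⟨ψ, rfl⟩ := exists_cls b
    obtain ⟨χ, rfl⟩ := exists_cls c
    exact theoremsOver_of_entails₂ hL h₁ h₂ fun w hw => by
      simp only [hw.imp, hw.disj]
      tauto
  inf_le_left a b := by
    obtain ⟨φ, rfl⟩ := exists_cls a
    obtain ⟨ψ, rfl⟩ := exists_cls b
    exact cls_le_of_valid fun w hw h => ((hw.conj _ _).1 h).1
  inf_le_right a b := by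
    obtain ⟨φ, rfl⟩ := exists_cls a
    obtain ⟨ψ, rfl⟩ := exists_cls b
    exact cls_le_of_valid fun w hw h => ((hw.conj _ _).1 h).2
  le_inf a b c h₁ h₂ := by
    obtain ⟨φ, rfl⟩ := exists_cls a
    obtain ⟨ψ, rfl⟩ := exists_cls b
    obtain ⟨χ, rfl⟩ := exists_cls c
    exact theoremsOver_of_entails₂ hL h₁ h₂ fun w hw => by
      simp only [hw.imp, hw.conj]
      tauto
  le_sup_inf a b c := by
    obtain ⟨φ, rfl⟩ := exists_cls a
    obtain ⟨ψ, rfl⟩ := exists_cls b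
    obtain ⟨χ, rfl⟩ := exists_cls c
    exact cls_le_of_valid (φ := conj (disj φ ψ) (disj φ χ)) (ψ := disj φ (conj ψ χ))
      fun w hw => by
        simp only [hw.disj, hw.conj]
        tauto
  inf_compl_le_bot a := by
    obtain ⟨φ, rfl⟩ := exists_cls a
    exact cls_le_of_valid (φ := conj φ (neg φ)) (ψ := falsum) fun w hw => by
      simp only [hw.neg, hw.conj]
      tauto
  top_le_sup_compl a := by
    obtain ⟨φ, rfl⟩ := exists_cls a
    exact cls_le_of_valid (φ := verum) (ψ := disj φ (neg φ)) fun w hw => by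
      simp only [hw.neg, hw.disj]
      tauto
  le_top a := by
    obtain ⟨φ, rfl⟩ := exists_cls a
    exact cls_le_of_valid fun w hw _ => hw.verum
  bot_le a := by
    obtain ⟨φ, rfl⟩ := exists_cls a
    exact cls_le_of_valid fun w hw h => absurd h hw.falsum

instance : ModalAlgebra (Lindenbaum hL α) where
  diam := Quotient.lift (fun φ => cls hL (dia φ)) fun _ _ h =>
    cls_eq_cls.2 ⟨theoremsOver_dia_mono hL h.1, theoremsOver_dia_mono hL h.2⟩
  diam_bot := cls_eq_cls.2
    ⟨theoremsOver_of_entails hL (theoremsOver_neg_dia_falsum hL) fun w hw => by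
      simp only [hw.imp, hw.neg]
      tauto, cls_le_of_valid (hL := hL) fun w hw h => absurd h hw.falsum⟩
  diam_sup a b := by
    obtain ⟨φ, rfl⟩ := exists_cls a
    obtain ⟨ψ, rfl⟩ := exists_cls b
    refine cls_eq_cls.2 ⟨theoremsOver_dia_disj hL φ ψ, ?_⟩
    have h₁ : imp φ (disj φ ψ) ∈ theoremsOver L α := theoremsOver_of_valid hL fun w hw => by
      simp only [hw.imp, hw.disj]
      tauto
    have h₂ : imp ψ (disj φ ψ) ∈ theoremsOver L α := theoremsOver_of_valid hL fun w hw => by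
      simp only [hw.imp, hw.disj]
      tauto
    exact theoremsOver_of_entails₂ hL (theoremsOver_dia_mono hL h₁)
      (theoremsOver_dia_mono hL h₂) fun w hw => by
        simp only [hw.imp, hw.disj]
        tauto

theorem cls_falsum : cls hL (falsum : Formula α) = ⊥ := rfl

theorem cls_neg (φ : Formula α) : cls hL (neg φ) = (cls hL φ)ᶜ := rfl

theorem cls_eq_top {φ : Formula α} (h : φ ∈ theoremsOver L α) : cls hL φ = ⊤ :=
  top_le_iff.1 (theoremsOver_of_entails hL h fun _ hw hφ => (hw.imp verum φ).2 fun _ => hφ)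

theorem value_cls (σ : ℕ → Formula α) (φ : Formula ℕ) :
    φ.value (fun i => cls hL (σ i)) = cls hL (φ.subst σ) := by
  induction φ with
  | atom i => rfl
  | verum => rfl
  | neg φ ih => rw [value, ih]; rfl
  | disj φ ψ ih₁ ih₂ => rw [value, ih₁, ih₂]; rfl
  | dia φ ih => rw [value, ih]; rfl

theorem inVariety (hL : IsNormalLogic L) (α : Type u) : InVariety L (Lindenbaum hL α) := by
  intro φ hφ v
  choose σ hσ using fun i => exists_cls (v i)
  obtain rfl : (fun i => cls hL (σ i)) = v := funext hσ
  rw [value_cls]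
  exact cls_eq_top ⟨φ, hφ, σ, rfl⟩

theorem isGeneratedInPower_aleph0 (hL : IsNormalLogic L) :
    IsGeneratedInPower (Lindenbaum hL ℕ) Cardinal.aleph0 := by
  refine ⟨Set.range fun i => cls hL (atom i), Cardinal.le_aleph0_iff_set_countable.2
    (Set.countable_range _), fun T hS hT => Set.eq_univ_of_forall fun a => ?_⟩
  obtain ⟨φ, rfl⟩ := exists_cls a
  induction φ with
  | atom i => exact hS ⟨i, rfl⟩
  | verum => exact hT.top_mem
  | neg φ ih => exact hT.compl_mem _ ih
  | disj φ ψ ih₁ ih₂ => exact hT.sup_mem _ ih₁ _ ih₂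
  | dia φ ih => exact hT.diam_mem _ ih

end Lindenbaum

/-! ### Evaluation of formulas and homomorphisms out of the Lindenbaum algebra -/

theorem Formula.value_subst {A : Type u} [ModalAlgebra A] (v : ℕ → A) (σ : ℕ → Formula ℕ)
    (φ : Formula ℕ) : (φ.subst σ).value v = φ.value fun i => (σ i).value v := by
  induction φ with
  | atom i => rfl
  | verum => rfl
  | neg φ ih => rw [subst, value, value, ih]
  | disj φ ψ ih₁ ih₂ => rw [subst, value, value, ih₁, ih₂]
  | dia φ ih => rw [subst, value, value, ih]

theorem Formula.value_imp_eq_top {A : Type u} [ModalAlgebra A] {v : ℕ → A} {φ ψ : Formula ℕ} :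
    (imp φ ψ).value v = ⊤ ↔ φ.value v ≤ ψ.value v := by
  rw [imp, value, value, ← himp_eq_top_iff, himp_eq, sup_comm]

theorem InVariety.value_eq_top {L : Set (Formula ℕ)} {A : Type u} [ModalAlgebra A]
    (hA : InVariety L A) {φ : Formula ℕ} (hφ : φ ∈ theoremsOver L ℕ) (v : ℕ → A) :
    φ.value v = ⊤ := by
  obtain ⟨ψ, hψ, σ, rfl⟩ := hφ
  rw [value_subst]
  exact hA ψ hψ _

/-- The homomorphism from the Lindenbaum algebra over `ℕ` extending an assignment of values to
the atoms. -/
def Lindenbaum.lift {L : Set (Formula ℕ)} (hL : IsNormalLogic L) {A : Type u} [ModalAlgebra A]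
    (hA : InVariety L A) (v : ℕ → A) : BoundedLatticeHom (Lindenbaum hL ℕ) A where
  toFun := Quotient.lift (fun φ => φ.value v) fun _ _ h => le_antisymm
    (value_imp_eq_top.1 (hA.value_eq_top h.1 v)) (value_imp_eq_top.1 (hA.value_eq_top h.2 v))
  map_sup' a b := by
    obtain ⟨φ, rfl⟩ := exists_cls a
    obtain ⟨ψ, rfl⟩ := exists_cls b
    rfl
  map_inf' a b := by
    obtain ⟨φ, rfl⟩ := exists_cls a
    obtain ⟨ψ, rfl⟩ := exists_cls b
    change ((φ.value v)ᶜ ⊔ (ψ.value v)ᶜ)ᶜ = φ.value v ⊓ ψ.value v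
    rw [compl_sup, compl_compl, compl_compl]
  map_top' := rfl
  map_bot' := compl_top

/-! ## Comparison of the frames -/

theorem KripkeFrame.sat_iff_of_equiv {F : KripkeFrame.{u}} {G : KripkeFrame.{v}}
    (e : F.World ≃ G.World) (he : ∀ w z, F.Rel w z ↔ G.Rel (e w) (e z))
    (g : ℕ → Set F.World) (φ : Formula ℕ) (w : F.World) :
    F.Sat g w φ ↔ G.Sat (fun i => e.symm ⁻¹' g i) (e w) φ := by
  induction φ generalizing w with
  | atom i => simp [Sat]
  | verum => exact Iff.rfl
  | neg φ ih => exact not_congr (ih w)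
  | disj φ ψ ih₁ ih₂ => exact or_congr (ih₁ w) (ih₂ w)
  | dia φ ih =>
    simp only [Sat, he, ih]
    exact e.exists_congr_left.trans (by simp)

theorem KripkeFrame.Validates.of_equiv {F : KripkeFrame.{u}} {G : KripkeFrame.{v}}
    {S : Set (Formula ℕ)} (e : F.World ≃ G.World) (he : ∀ w z, F.Rel w z ↔ G.Rel (e w) (e z))
    (h : G.Validates S) : F.Validates S := fun φ hφ g w =>
  (sat_iff_of_equiv e he g φ w).2 (h φ hφ _ _)

/-- Assignments in the algebra of sets of ultrafilters are valuations on the ultrafilter frame, and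
the value of a formula is its truth set. -/
theorem inVariety_canonicalExtension_iff {L : Set (Formula ℕ)} {A : Type u} [ModalAlgebra A] :
    InVariety L (CanonicalExtension A) ↔ (ultrafilterFrame A).Validates L := by
  have key : ∀ (g : ℕ → Set (ultrafilterFrame A).World) (φ : Formula ℕ),
      φ.value (A := CanonicalExtension A) g =
        ({w | (ultrafilterFrame A).Sat g w φ} : Set (ultrafilterFrame A).World) := by
    intro g φ
    induction φ with
    | atom i => rfl
    | verum => rfl
    | neg φ ih => exact congrArg (·ᶜ) ih
    | disj φ ψ ih₁ ih₂ => exact congrArg₂ (· ⊔ ·) ih₁ ih₂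
    | dia φ ih => exact congrArg ModalAlgebra.diam ih
  refine forall₂_congr fun φ _ => forall_congr' fun g => ?_
  rw [key g φ]
  exact Set.eq_univ_iff_forall

/-! ### Maximally consistent sets as ultrafilters of the Lindenbaum algebra -/

section MaximalConsistent

variable {L : Set (Formula ℕ)} {α : Type u} {Γ : Set (Formula α)}

theorem listConj_filter_ne {w : Formula α → Prop} (hw : IsAssignment w) [DecidableEq (Formula α)]
    {l : List (Formula α)} {φ : Formula α} (hφ : w φ)
    (h : w (listConj (l.filter (· ≠ φ)))) : w (listConj l) := by
  rw [hw.listConj] at *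
  intro ψ hψ
  by_cases hc : ψ = φ
  · rwa [hc]
  · exact h ψ (by simp [hψ, hc])

/-- Adjoining a provable consequence preserves consistency: in any finite list it can be replaced by
the premises `l`. Maximality then puts it in `Γ`. -/
theorem mem_of_provable (hL : IsNormalLogic L) (hΓ : Maximal (IsConsistent L) Γ)
    {l : List (Formula α)} (hl : ∀ ψ ∈ l, ψ ∈ Γ) {φ : Formula α}
    (h : imp (listConj l) φ ∈ theoremsOver L α) : φ ∈ Γ := by
  classical
  refine hΓ.2 (y := insert φ Γ) ?_ (Set.subset_insert φ Γ) (Set.mem_insert φ Γ)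
  intro l' hl' hneg
  refine hΓ.1 (l ++ l'.filter (· ≠ φ)) ?_ (theoremsOver_of_entails₂ hL h hneg fun w hw => ?_)
  · intro ψ hψ
    rcases List.mem_append.1 hψ with hψ | hψ
    · exact hl ψ hψ
    · simp only [List.mem_filter, decide_eq_true_eq] at hψ
      exact (hl' ψ hψ.1).resolve_left hψ.2
  · rw [hw.imp, hw.neg, hw.neg]
    intro h₁ h₂ h₃
    rw [hw.listConj] at h₃
    refine h₂ (listConj_filter_ne hw (h₁ ?_) ?_)
    · exact (hw.listConj l).2 fun ψ hψ => h₃ ψ (List.mem_append_left _ hψ)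
    · exact (hw.listConj _).2 fun ψ hψ => h₃ ψ (List.mem_append_right _ hψ)

theorem mem_or_neg_mem (hL : IsNormalLogic L) (hΓ : Maximal (IsConsistent L) Γ) (φ : Formula α) :
    φ ∈ Γ ∨ neg φ ∈ Γ := by
  classical
  refine or_iff_not_imp_left.2 fun hφ => ?_
  have hc : ¬ IsConsistent L (insert φ Γ) := fun hc =>
    hφ (hΓ.2 hc (Set.subset_insert φ Γ) (Set.mem_insert φ Γ))
  simp only [IsConsistent, not_forall, not_not] at hc
  obtain ⟨l, hl, hneg⟩ := hc
  refine mem_of_provable hL hΓ (l := l.filter (· ≠ φ)) ?_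
    (theoremsOver_of_entails hL hneg fun w hw => ?_)
  · intro ψ hψ
    simp only [List.mem_filter, decide_eq_true_eq] at hψ
    exact (hl ψ hψ.1).resolve_left hψ.2
  · rw [hw.imp, hw.neg, hw.neg]
    exact fun h₁ h₂ h₃ => h₁ (listConj_filter_ne hw h₃ h₂)

end MaximalConsistent

/-- The formulas whose classes lie in an ultrafilter form a maximally consistent set. -/
theorem maximal_isConsistent_of_ultrafilter {L : Set (Formula ℕ)} (hL : IsNormalLogic L)
    {α : Type u} (μ : (ultrafilterFrame (Lindenbaum hL α)).World) :
    Maximal (IsConsistent L) {φ : Formula α | Lindenbaum.cls hL φ ∈ μ.1} := by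
  constructor
  · intro l hl h
    have hmem : Lindenbaum.cls hL (listConj l) ∈ μ.1 := by
      clear h
      induction l with
      | nil => exact ultrafilterFrame.top_mem μ
      | cons φ l ih =>
        exact ultrafilterFrame.inf_mem (a := Lindenbaum.cls hL φ) (hl φ (by simp))
          (ih fun ψ hψ => hl ψ (by simp [hψ]))
    refine ultrafilterFrame.compl_mem_iff.1 ?_ hmem
    rw [← Lindenbaum.cls_neg, Lindenbaum.cls_eq_top h]
    exact ultrafilterFrame.top_mem μ
  · intro Δ hΔ hsub φ hφ
    by_contra hc
    have hneg : neg φ ∈ Δ :=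
      hsub (ultrafilterFrame.compl_mem_iff (a := Lindenbaum.cls hL φ).2 hc)
    refine hΔ [φ, neg φ] (by simp [hφ, hneg]) (theoremsOver_of_valid hL fun w hw => ?_)
    rw [hw.neg, hw.listConj]
    simp [hw.neg]

/-- The canonical frame of `L` over `α` is isomorphic to the canonical frame of the Lindenbaum
algebra. -/
theorem exists_equiv_canonicalFrame {L : Set (Formula ℕ)} (hL : IsNormalLogic L) (α : Type u) :
    ∃ e : (ultrafilterFrame (Lindenbaum hL α)).World ≃ (canonicalFrame L α).World,
      ∀ μ ν, (ultrafilterFrame (Lindenbaum hL α)).Rel μ ν ↔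
        (canonicalFrame L α).Rel (e μ) (e ν) := by
  let f : (ultrafilterFrame (Lindenbaum hL α)).World → (canonicalFrame L α).World :=
    fun μ => ⟨_, maximal_isConsistent_of_ultrafilter hL μ⟩
  have hf : Function.Bijective f := by
    constructor
    · intro μ ν h
      refine ultrafilterFrame.world_ext fun a ha => ?_
      obtain ⟨φ, rfl⟩ := Lindenbaum.exists_cls a
      exact (Set.ext_iff.1 (congrArg Subtype.val h) φ).1 ha
    · rintro ⟨Γ, hΓ⟩
      have hcls : ∀ {φ ψ : Formula α}, φ ∈ Γ → Lindenbaum.cls hL φ ≤ Lindenbaum.cls hL ψ →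
          ψ ∈ Γ := fun {φ ψ} hφ h =>
        mem_of_provable hL hΓ (l := [φ]) (by simpa using hφ)
          (theoremsOver_of_entails hL (Lindenbaum.cls_le_cls.1 h) fun w hw => by
            rw [hw.imp, hw.imp, hw.listConj]
            simp)
      refine ⟨ultrafilterFrame.mk {a | ∃ φ ∈ Γ, Lindenbaum.cls hL φ = a} ?_ ?_ ?_ ?_ ?_, ?_⟩
      · refine ⟨verum, mem_of_provable hL hΓ (l := []) (by simp)
          (theoremsOver_of_valid hL fun w hw => ?_), rfl⟩
        exact (hw.imp _ _).2 fun _ => hw.verum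
      · rintro _ ⟨φ, hφ, rfl⟩ _ ⟨ψ, hψ, rfl⟩
        refine ⟨conj φ ψ, mem_of_provable hL hΓ (l := [φ, ψ]) (by simp [hφ, hψ])
          (theoremsOver_of_valid hL fun w hw => ?_), rfl⟩
        rw [hw.imp, hw.conj, hw.listConj]
        simp
      · rintro _ b h ⟨φ, hφ, rfl⟩
        obtain ⟨ψ, rfl⟩ := Lindenbaum.exists_cls b
        exact ⟨ψ, hcls hφ h, rfl⟩
      · rintro ⟨φ, hφ, h⟩
        have hfal : falsum ∈ Γ := hcls hφ (h.trans Lindenbaum.cls_falsum.symm).le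
        refine hΓ.1 [falsum] (by simpa using hfal) (theoremsOver_of_valid hL fun w hw => ?_)
        rw [hw.neg, hw.listConj]
        simpa using hw.falsum
      · intro a
        obtain ⟨φ, rfl⟩ := Lindenbaum.exists_cls a
        exact (mem_or_neg_mem hL hΓ φ).imp (fun h => ⟨φ, h, rfl⟩) fun h => ⟨_, h, rfl⟩
      · refine Subtype.ext (Set.ext fun φ => ⟨?_, fun h => ⟨φ, h, rfl⟩⟩)
        rintro ⟨ψ, hψ, h⟩
        exact hcls hψ h.le
  refine ⟨Equiv.ofBijective f hf, fun μ ν => ⟨fun h φ hφ => h _ hφ, fun h a ha => ?_⟩⟩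
  obtain ⟨φ, rfl⟩ := Lindenbaum.exists_cls a
  exact h φ ha

theorem validates_canonicalFrame_iff {L : Set (Formula ℕ)} (hL : IsNormalLogic L) (α : Type u) :
    (canonicalFrame L α).Validates L ↔ (ultrafilterFrame (Lindenbaum hL α)).Validates L := by
  obtain ⟨e, he⟩ := exists_equiv_canonicalFrame hL α
  exact ⟨.of_equiv e he, .of_equiv e.symm fun w z => by simp [he]⟩

/-! ### Transfer from the countable Lindenbaum algebra to the whole variety -/

theorem InVariety.disjoint_diam {L : Set (Formula ℕ)} (h52 : axiom52 ∈ L) {A : Type u}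
    [ModalAlgebra A] (hA : InVariety L A) (a : A) :
    Disjoint (ModalAlgebra.diam (ModalAlgebra.diam a))
      (ModalAlgebra.diam (ModalAlgebra.diam a)ᶜ) :=
  le_compl_iff_disjoint_right.1 (value_imp_eq_top.1 (hA _ h52 fun _ => a))

/-- If `L` is valid in the canonical frame of its countably generated Lindenbaum algebra, then it
is valid in the canonical frames of all members of its variety. -/
theorem validates_ultrafilterFrame {L : Set (Formula ℕ)} (hL : IsNormalLogic L)
    (h52 : axiom52 ∈ L) (h : (ultrafilterFrame (Lindenbaum hL ℕ)).Validates L)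
    {A : Type u} [ModalAlgebra A] (hA : InVariety L A) : (ultrafilterFrame A).Validates L := by
  intro φ hφ g γ
  by_contra hc
  obtain ⟨G, hG, hrefl⟩ := exists_countable_reflecting.{u, 0} (hA.disjoint_diam h52) g γ φ hc
  -- Adjoining `⊥` ensures nonemptiness, so that the set is the range of a sequence of values for
  -- the atoms.
  obtain ⟨v, hv⟩ := (hG.insert ⊥).exists_eq_range (Set.insert_nonempty _ _)
  obtain ⟨g', γ', hγ'⟩ := hrefl (Lindenbaum hL ℕ)
    ((Lindenbaum.inVariety hL ℕ).disjoint_diam h52) (Lindenbaum.lift hL hA v)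
    (fun b => by
      obtain ⟨ψ, rfl⟩ := Lindenbaum.exists_cls b
      rfl)
    (fun a ha => by
      obtain ⟨i, rfl⟩ : a ∈ Set.range v := hv ▸ Set.mem_insert_of_mem _ ha
      exact ⟨Lindenbaum.cls hL (atom i), rfl⟩)
  exact hγ' (h φ hφ g' γ')

end ModalLogic

/-- Every normal logic extending `K5₂` that is `ω`-canonical is totally canonical, both for
canonicity of the logic (validity in its canonical frames) and for canonicity of the
corresponding variety (closure under canonical extensions). -/
theorem mainTheorem3 (L : Set (ModalLogic.Formula ℕ)) (hL : ModalLogic.IsNormalLogic L)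
    (h52 : ModalLogic.K52 ⊆ L) :
    (ModalLogic.IsCanonicalInPower.{0} L Cardinal.aleph0 →
      ModalLogic.IsTotallyCanonical.{u} L) ∧
    (ModalLogic.IsVarietyCanonicalInPower.{0} L Cardinal.aleph0 →
      ModalLogic.IsVarietyTotallyCanonical.{u} L) := by
  have hax : ModalLogic.axiom52 ∈ L := h52 fun _ _ h => h
  constructor
  · intro h κ α _
    rw [ModalLogic.validates_canonicalFrame_iff hL]
    -- The canonical frame over `α` is the case of the Lindenbaum algebra over `α`, whatever its
    -- cardinality.
    exact ModalLogic.validates_ultrafilterFrame hL hax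
      ((ModalLogic.validates_canonicalFrame_iff hL ℕ).1 (h ℕ Cardinal.mk_nat))
      (ModalLogic.Lindenbaum.inVariety hL α)
  · intro h A _ hA
    rw [ModalLogic.inVariety_canonicalExtension_iff]
    exact ModalLogic.validates_ultrafilterFrame hL hax
      (ModalLogic.inVariety_canonicalExtension_iff.1 (h _ (ModalLogic.Lindenbaum.inVariety hL ℕ)
        (ModalLogic.Lindenbaum.isGeneratedInPower_aleph0 hL))) hA
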